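/- A \emph{countable Borel quasi-order} on a standard Borel space $X$ is a reflexive and transitive relation $Q$ on $X$ that is Borel as a subset of $X^2$ and such that $\{y \mid y \mathbin{Q} x\}$ is countable for every $x \in X$. It is \emph{universal} if for every countable Borel quasi-order $P$ on a standard Borel space $Y$ there is a Borel map $f : Y \to X$ with $x \mathbin{P} y \Leftrightarrow f(x) \mathbin{Q} f(y)$ for all $x, y \in Y$. For a countable group $G$, give the power set $\mathcal{P}(G) = 2^G$ its product Borel structure, let $\Omega(G) \subseteq \mathcal{P}(G)$ be the subspace of infinite subsets of $G$, and for $A, B \in \mathcal{P}(G)$ put $$A \preccurlyeq_t^G B \iff A = g_1 B \cap \dots \cap g_n B \text{ for some } n \ge 1 \text{ and } g_1, \dots, g_n \in G.$$ Let $\mathbb{F}_\infty$ be the free group on countably infinitely many generators and $\mathbb{F}_2$ the free group on two generators. Then: 1. the restriction of $\preccurlyeq_t^{\mathbb{F}_\infty}$ to $\Omega(\mathbb{F}_\infty)$ is a universal countable Borel quasi-order; 2. the restriction of $\preccurlyeq_t^{\mathbb{F}_2}$ to $\Omega(\mathbb{F}_2)$ is a universal countable Borel quasi-order, and so is $\preccurlyeq_t^{\mathbb{F}_2}$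 on all of $\mathcal{P}(\mathbb{F}_2)$; 3. if $G$ is any countable group containing a subgroup isomorphic to $\mathbb{F}_2$, then the restriction of $\preccurlyeq_t^G$ to $\Omega(G)$ is a universal countable Borel quasi-order. -/

import Mathlib

open scoped Pointwise

universe u v

/-- `Q` is a countable Borel quasi-order on the standard Borel space `X`: it is reflexive and
transitive, it is Borel as a subset of `X × X`, and every point has only countably many
predecessors. -/
structure IsCountableBorelQuasiOrder {X : Type*} [MeasurableSpace X] (Q : X → X → Prop) : Prop where
  standardBorel : StandardBorelSpace X
  refl : ∀ x, Q x x
  trans : ∀ x y z, Q x y → Q y z → Q x z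
  borel : MeasurableSet {p : X × X | Q p.1 p.2}
  countable_predecessors : ∀ x, {y | Q y x}.Countable

/-- Borel reducibility `Q ≤_B Q'`. -/
def BorelReducible {X Y : Type*} [MeasurableSpace X] [MeasurableSpace Y]
    (Q : X → X → Prop) (Q' : Y → Y → Prop) : Prop :=
  ∃ f : X → Y, Measurable f ∧ ∀ x y, Q x y ↔ Q' (f x) (f y)

/-- `Q'` is a universal countable Borel quasi-order: it is a countable Borel quasi-order, and every
countable Borel quasi-order (on a standard Borel space in an arbitrary universe `w`) is Borel
reducible to it. -/
def IsUniversalCountableBorelQuasiOrder.{w, w'} {Y : Type w'} [MeasurableSpace Y]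
    (Q' : Y → Y → Prop) : Prop :=
  IsCountableBorelQuasiOrder Q' ∧
    ∀ (X : Type w) [MeasurableSpace X] (Q : X → X → Prop),
      IsCountableBorelQuasiOrder Q → BorelReducible Q Q'

/-- `A ≼_t^G B`: `A` is the intersection of finitely many (at least one) left translates of `B`.
The space `𝒫(G)` is `Set G` with Mathlib's measurable structure, the product structure of
`G → Prop`; for countable `G` it is the Borel structure of the Cantor topology. -/
def TranslateIntersectionLE (G : Type*) [Group G] (A B : Set G) : Prop :=
  ∃ n : ℕ, 1 ≤ n ∧ ∃ g : Fin n → G, A = ⋂ i, g i • B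

/-- `Ω(G)`, the space of infinite subsets of `G`, as a subspace of `𝒫(G)`. -/
abbrev InfiniteSubsets (G : Type*) : Type _ := {A : Set G // A.Infinite}

/-- The restriction of `≼_t^G` to `Ω(G)`. -/
def TranslateIntersectionLEOnInfinite (G : Type*) [Group G] (A B : InfiniteSubsets G) : Prop :=
  TranslateIntersectionLE G A.1 B.1

/-! A countable Borel quasi-order `Q` is generated by Borel functions `f n`: the predecessors of `x`
are exactly the points `f n x`. This is Lusin–Novikov uniformization, obtained from
`Measurable.exists_cover_injOn`: a continuous map that is not injective on the pieces of any
countable Borel cover admits a Cantor scheme inside one fiber.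

A point `x` is then coded by the set of positive words it accepts, one letter per function, one per
bit test, and a letter `none` that accepts whatever follows. Left translation by an inverse letter
reads that letter. Reading the letter of `f n` moves to `f n x`, and intersecting with the
`none`-translate discards non-positive elements, so the code of `f n x` is an intersection of two
translates of the code of `x` (`codeSet_apply`). Conversely, if the code of `y` is an intersection
of translates of the code of `x`, some translate comes from a word leading from `x` to a point below
`x`, and the bit tests identify that point with `y` (`translateIntersectionLE_codeSet_iff`).

Codes are infinite, and injective homomorphisms preserve and reflect the relation on nonempty sets,
so the construction transfers along an embedding of the free group on the letters into any group
containing a copy of the free group on two generators. -/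

/-! ### Countable-to-one Borel maps are countable unions of injective ones -/

section LusinNovikov

open MeasureTheory Set TopologicalSpace

/-- `N` is covered by countably many measurable sets on each of which `f` is injective. -/
def CoveredByInjOn {E X : Type*} [MeasurableSpace E] (f : E → X) (N : Set E) : Prop :=
  ∃ B : ℕ → Set E, (∀ n, MeasurableSet (B n)) ∧ (∀ n, InjOn f (B n)) ∧ N ⊆ ⋃ n, B n

namespace CoveredByInjOn

variable {E X : Type*} [MeasurableSpace E] {f : E → X}

theorem mono {N N' : Set E} (h : CoveredByInjOn f N) (hN : N' ⊆ N) : CoveredByInjOn f N' :=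
  let ⟨B, hB, hi, hc⟩ := h
  ⟨B, hB, hi, hN.trans hc⟩

theorem of_injOn {C : Set E} (hC : MeasurableSet C) (h : InjOn f C) : CoveredByInjOn f C :=
  ⟨fun _ => C, fun _ => hC, fun _ => h, subset_iUnion (fun _ : ℕ => C) 0⟩

theorem iUnion {ι : Type*} [Countable ι] {N : ι → Set E} (h : ∀ i, CoveredByInjOn f (N i)) :
    CoveredByInjOn f (⋃ i, N i) := by
  choose B hB hi hc using h
  cases isEmpty_or_nonempty (ι × ℕ) with
  | inl hι =>
    refine ⟨fun _ => ∅, by simp, by simp, ?_⟩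
    have : IsEmpty ι := ⟨fun i => hι.elim (i, 0)⟩
    simp
  | inr hι =>
    obtain ⟨e, he⟩ := exists_surjective_nat (ι × ℕ)
    refine ⟨fun n => B (e n).1 (e n).2, fun n => hB _ _, fun n => hi _ _, ?_⟩
    refine iUnion_subset fun i x hx => ?_
    obtain ⟨k, hk⟩ := mem_iUnion.1 (hc i hx)
    obtain ⟨n, hn⟩ := he (i, k)
    exact mem_iUnion.2 ⟨n, by simpa [hn] using hk⟩

end CoveredByInjOn

/-! ### Positive families and Cantor schemes for continuous maps. -/

section Polish

variable {E X : Type*} [TopologicalSpace E] [PolishSpace E] [MeasurableSpace E] [BorelSpace E]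
  [TopologicalSpace X] [PolishSpace X] {f : E → X}

/-- An analytic set on which a continuous map is injective is contained in a Borel set with the
same property. -/
theorem MeasureTheory.AnalyticSet.exists_measurableSet_injOn (hf : Continuous f) {A : Set E}
    (hA : AnalyticSet A) (hinj : InjOn f A) :
    ∃ C, MeasurableSet C ∧ A ⊆ C ∧ InjOn f C := by
  let N : Set E → Set E := fun A =>
    Prod.snd '' ((Prod.fst ⁻¹' A) ∩ {p : E × E | p.1 ≠ p.2 ∧ f p.1 = f p.2})
  have hD : MeasurableSet {p : E × E | p.1 ≠ p.2 ∧ f p.1 = f p.2} := by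
    refine MeasurableSet.inter ?_ ?_
    · exact (isOpen_ne_fun continuous_fst continuous_snd).measurableSet
    · exact (isClosed_eq (hf.comp continuous_fst) (hf.comp continuous_snd)).measurableSet
  have hN : ∀ {A : Set E}, AnalyticSet A → AnalyticSet (N A) := fun {A} hA => by
    refine AnalyticSet.image_of_continuous ?_ continuous_snd
    rw [inter_eq_iInter]
    refine AnalyticSet.iInter fun b => ?_
    cases b
    · exact hD.analyticSet
    · exact hA.preimage continuous_fst
  have mem_N : ∀ {A : Set E} {v : E}, v ∈ N A ↔ ∃ u ∈ A, u ≠ v ∧ f u = f v := by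
    intro A v
    constructor
    · rintro ⟨⟨a, b⟩, ⟨ha, h⟩, rfl⟩
      exact ⟨a, ha, h⟩
    · rintro ⟨a, ha, h⟩
      exact ⟨(a, v), ⟨ha, h⟩, rfl⟩
  -- `N A` consists of the points sharing their value with another point of `A`. Since `N` comes
  -- from a symmetric relation, `C₁` missing `N A` means that `A` misses `N C₁`, which permits the
  -- second separation.
  obtain ⟨C₁, hAC₁, hd₁, hC₁⟩ := hA.measurablySeparable (hN hA) (by
    rw [Set.disjoint_left]
    intro v hv hvN
    obtain ⟨u, hu, hne, he⟩ := mem_N.1 hvN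
    exact hne (hinj hu hv he))
  obtain ⟨C₂, hAC₂, hd₂, hC₂⟩ := hA.measurablySeparable (hN hC₁.analyticSet) (by
    rw [Set.disjoint_left]
    intro v hv hvN
    obtain ⟨u, hu, hne, he⟩ := mem_N.1 hvN
    exact Set.disjoint_left.1 hd₁ (mem_N.2 ⟨v, hv, hne.symm, he.symm⟩) hu)
  refine ⟨C₁ ∩ C₂, hC₁.inter hC₂, subset_inter hAC₁ hAC₂, fun u hu v hv he => ?_⟩
  by_contra hne
  exact Set.disjoint_left.1 hd₂ (mem_N.2 ⟨u, hu.1, hne, he⟩) hv.2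

/-- A family `𝒰` of subsets of `E` is positive for `f` if, after removal of any measurable set
covered by countably many measurable sets of injectivity, the images of its members still have a
common point. -/
def PositiveFamily (f : E → X) (𝒰 : Set (Set E)) : Prop :=
  ∀ B, MeasurableSet B → CoveredByInjOn f Bᶜ → ∃ x, ∀ U ∈ 𝒰, x ∈ f '' (U ∩ B)

/-- If every pair of small basic sets failed, the countably many witnesses of failure would
intersect in one set `D`. Then `f` is injective on the part of `U ∩ D` whose values are attained on
every `V ∩ D`, and deleting a Borel hull of that part contradicts positivity. -/
theorem PositiveFamily.split {E X : Type*} [MetricSpace E] [PolishSpace E] [MeasurableSpace E]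
    [BorelSpace E] [TopologicalSpace X] [PolishSpace X] {f : E → X} (hf : Continuous f)
    {U : Set E} (hU : IsOpen U) {𝒱 : Set (Set E)} (hc : 𝒱.Countable)
    (ho : ∀ V ∈ 𝒱, IsOpen V) (hpos : PositiveFamily f (insert U 𝒱)) {ε : ℝ} (hε : 0 < ε) :
    ∃ V W, IsOpen V ∧ IsOpen W ∧ Disjoint V W ∧ closure V ⊆ U ∧ closure W ⊆ U ∧
      (∀ a ∈ V, ∀ b ∈ V, dist a b ≤ ε) ∧ (∀ a ∈ W, ∀ b ∈ W, dist a b ≤ ε) ∧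
      PositiveFamily f (insert V (insert W 𝒱)) := by
  by_contra hcon
  let 𝒮 : Set (Set E × Set E) := {p | p.1 ∈ countableBasis E ∧ p.2 ∈ countableBasis E ∧
    Disjoint p.1 p.2 ∧ closure p.1 ⊆ U ∧ closure p.2 ⊆ U ∧
      (∀ a ∈ p.1, ∀ b ∈ p.1, dist a b ≤ ε) ∧ (∀ a ∈ p.2, ∀ b ∈ p.2, dist a b ≤ ε)}
  have h𝒮 : 𝒮.Countable :=
    ((countable_countableBasis E).prod (countable_countableBasis E)).mono
      fun p hp => Set.mem_prod.2 ⟨hp.1, hp.2.1⟩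
  have key : ∀ p : 𝒮, ∃ B, MeasurableSet B ∧ CoveredByInjOn f Bᶜ ∧
      ¬ ∃ x, ∀ Z ∈ insert p.1.1 (insert p.1.2 𝒱), x ∈ f '' (Z ∩ B) := by
    rintro ⟨⟨V, W⟩, hV, hW, h⟩
    by_contra hp
    refine hcon ⟨V, W, isOpen_of_mem_countableBasis hV, isOpen_of_mem_countableBasis hW,
      h.1, h.2.1, h.2.2.1, h.2.2.2.1, h.2.2.2.2, fun B hB hBc => ?_⟩
    by_contra hx
    exact hp ⟨B, hB, hBc, hx⟩
  choose B hBm hBc hB using key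
  have := h𝒮.to_subtype
  have := hc.to_subtype
  have hBsm : MeasurableSet (⋂ p, B p) := MeasurableSet.iInter hBm
  have hBsc : CoveredByInjOn f (⋂ p, B p)ᶜ := by
    rw [compl_iInter]
    exact CoveredByInjOn.iUnion hBc
  set D := ⋂ p, B p with hD
  let A : Set E := ⋂ o : Option 𝒱, o.elim (U ∩ D) fun V => f ⁻¹' (f '' (V.1 ∩ D))
  have hA : AnalyticSet A := by
    refine AnalyticSet.iInter fun o => ?_
    cases o with
    | none => exact (hU.measurableSet.inter hBsm).analyticSet
    | some V =>
      exact (((ho V.1 V.2).measurableSet.inter hBsm).analyticSet.image_of_continuous hf).preimage hf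
  -- Two points of `A` with equal values could be separated by a pair in `𝒮`, and their common value
  -- would refute the failure of that pair.
  have hAi : InjOn f A := by
    intro a ha b hb hab
    by_contra hne
    have haU := mem_iInter.1 ha none
    have hbU := mem_iInter.1 hb none
    have sep : ∀ c ∈ U, ∃ V ∈ countableBasis E, c ∈ V ∧
        closure V ⊆ U ∩ Metric.ball c (min (ε / 2) (dist a b / 2)) := fun c hc => by
      have hpos : 0 < min (ε / 2) (dist a b / 2) :=
        lt_min (half_pos hε) (half_pos (dist_pos.2 hne))
      exact (isBasis_countableBasis E).exists_closure_subset
        (Filter.inter_mem (hU.mem_nhds hc) (Metric.ball_mem_nhds c hpos))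
    obtain ⟨V, hV, haV, hVc⟩ := sep a haU.1
    obtain ⟨W, hW, hbW, hWc⟩ := sep b hbU.1
    have small : ∀ {c : E} {V : Set E},
        closure V ⊆ U ∩ Metric.ball c (min (ε / 2) (dist a b / 2)) →
        ∀ y ∈ V, ∀ z ∈ V, dist y z ≤ ε := fun {c V} h y hy z hz => by
      have h1 := (lt_min_iff.1 (Metric.mem_ball.1 (h (subset_closure hy)).2)).1
      have h2 := (lt_min_iff.1 (Metric.mem_ball.1 (h (subset_closure hz)).2)).1
      have := dist_triangle_right y z c
      linarith
    have hdis : Disjoint V W := by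
      rw [Set.disjoint_left]
      intro y hy hz
      have h1 := (lt_min_iff.1 (Metric.mem_ball.1 (hVc (subset_closure hy)).2)).2
      have h2 := (lt_min_iff.1 (Metric.mem_ball.1 (hWc (subset_closure hz)).2)).2
      have := dist_triangle_left a b y
      linarith
    let p : 𝒮 := ⟨(V, W), hV, hW, hdis, hVc.trans inter_subset_left, hWc.trans inter_subset_left,
      small hVc, small hWc⟩
    have hDp : D ⊆ B p := iInter_subset B p
    refine hB p ⟨f a, ?_⟩
    rintro Z (rfl | rfl | hZ)
    · exact ⟨a, ⟨haV, hDp haU.2⟩, rfl⟩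
    · exact ⟨b, ⟨hbW, hDp hbU.2⟩, hab.symm⟩
    · exact image_mono (inter_subset_inter_right Z hDp) (mem_iInter.1 ha (some ⟨Z, hZ⟩))
  obtain ⟨C, hC, hAC, hCi⟩ := hA.exists_measurableSet_injOn hf hAi
  obtain ⟨x, hx⟩ := hpos (D \ C) (hBsm.diff hC) (by
    have : CoveredByInjOn f (⋃ b : Bool, cond b Dᶜ C) :=
      CoveredByInjOn.iUnion fun b => by
        cases b
        · exact CoveredByInjOn.of_injOn hC hCi
        · exact hBsc
    refine this.mono fun y hy => ?_
    by_cases hyC : y ∈ C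
    · exact mem_iUnion.2 ⟨false, hyC⟩
    · exact mem_iUnion.2 ⟨true, fun hyD => hy ⟨hyD, hyC⟩⟩)
  obtain ⟨a, ⟨haU, haD, haC⟩, rfl⟩ := hx U (mem_insert _ _)
  refine haC (hAC (mem_iInter.2 fun o => ?_))
  cases o with
  | none => exact ⟨haU, haD⟩
  | some V =>
    exact image_mono (inter_subset_inter_right V.1 sdiff_subset) (hx V.1 (mem_insert_of_mem _ V.2))

/-- The family `𝒱` holds the sets not to be split at the current induction step, so that positivity
stays joint. -/
theorem PositiveFamily.split_all {E X : Type*} [MetricSpace E] [PolishSpace E] [MeasurableSpace E]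
    [BorelSpace E] [TopologicalSpace X] [PolishSpace X] {f : E → X} (hf : Continuous f)
    {ε : ℝ} (hε : 0 < ε) {𝒰 : Set (Set E)} (hfin : 𝒰.Finite) :
    ∀ 𝒱 : Set (Set E), 𝒱.Countable → (∀ V ∈ 𝒰 ∪ 𝒱, IsOpen V) → PositiveFamily f (𝒰 ∪ 𝒱) →
      ∃ 𝒰' : Set (Set E), 𝒰'.Finite ∧ (∀ V ∈ 𝒰', IsOpen V) ∧ PositiveFamily f (𝒰' ∪ 𝒱) ∧
        ∀ U ∈ 𝒰, ∃ c : Bool → Set E, Disjoint (c false) (c true) ∧ ∀ i, c i ∈ 𝒰' ∧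
          closure (c i) ⊆ U ∧ ∀ a ∈ c i, ∀ b ∈ c i, dist a b ≤ ε := by
  induction 𝒰, hfin using Set.Finite.induction_on with
  | empty => exact fun 𝒱 _ _ hp => ⟨∅, finite_empty, by simp, hp, by simp⟩
  | @insert U 𝒰 _ _ ih =>
    intro 𝒱 hc ho hp
    have hU : IsOpen U := ho U (Or.inl (mem_insert _ _))
    obtain ⟨𝒰', hf', ho', hp', hs'⟩ := ih (insert U 𝒱) (hc.insert U)
      (by rwa [union_insert, ← insert_union]) (by rwa [union_insert, ← insert_union])
    rw [union_insert] at hp'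
    obtain ⟨V, W, hV, hW, hVW, hVU, hWU, hVd, hWd, hp''⟩ := hp'.split hf hU
      (hf'.countable.union hc) (by
        rintro Z (hZ | hZ)
        · exact ho' Z hZ
        · exact ho Z (Or.inr hZ)) hε
    refine ⟨insert V (insert W 𝒰'), (hf'.insert W).insert V, ?_, ?_, ?_⟩
    · rintro Z (rfl | rfl | hZ)
      exacts [hV, hW, ho' Z hZ]
    · rwa [insert_union, insert_union]
    · rintro Z (rfl | hZ)
      · refine ⟨fun b => cond b W V, hVW, fun i => ?_⟩
        cases i
        · exact ⟨mem_insert _ _, hVU, hVd⟩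
        · exact ⟨mem_insert_of_mem _ (mem_insert _ _), hWU, hWd⟩
      · obtain ⟨c, hc1, hc2⟩ := hs' Z hZ
        exact ⟨c, hc1, fun i =>
          ⟨mem_insert_of_mem _ (mem_insert_of_mem _ (hc2 i).1), (hc2 i).2⟩⟩

theorem PositiveFamily.exists_uncountable_fiber {E X : Type*} [MetricSpace E] [CompleteSpace E]
    [PolishSpace E] [MeasurableSpace E] [BorelSpace E] [TopologicalSpace X] [PolishSpace X]
    {f : E → X} (hf : Continuous f) (h : PositiveFamily f {univ}) :
    ∃ x, ¬ (f ⁻¹' {x}).Countable := by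
  let State := {𝒰 : Set (Set E) // 𝒰.Finite ∧ (∀ V ∈ 𝒰, IsOpen V) ∧ PositiveFamily f 𝒰}
  have step : ∀ (n : ℕ) (𝒰 : State), ∃ 𝒰' : State, ∀ U : 𝒰.1, ∃ c : Bool → 𝒰'.1,
      Disjoint (c false).1 (c true).1 ∧ ∀ i, closure (c i).1 ⊆ U.1 ∧
        ∀ a ∈ (c i).1, ∀ b ∈ (c i).1, dist a b ≤ (1 / 2 : ℝ) ^ n := by
    rintro n ⟨𝒰, hfin, ho, hp⟩
    obtain ⟨𝒰', hf', ho', hp', hs⟩ := PositiveFamily.split_all hf (ε := (1 / 2 : ℝ) ^ n)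
      (by positivity) hfin ∅ countable_empty (by simpa using ho) (by simpa using hp)
    refine ⟨⟨𝒰', hf', ho', by simpa using hp'⟩, fun U => ?_⟩
    obtain ⟨c, hc1, hc2⟩ := hs U.1 U.2
    exact ⟨fun i => ⟨c i, (hc2 i).1⟩, hc1, fun i => (hc2 i).2⟩
  choose next child hdis hchild using step
  let S : ℕ → State := fun n => Nat.rec ⟨{univ}, finite_singleton _, by simp, h⟩ next n
  let D : ∀ n, (ℕ → Bool) → (S n).1 := fun n b =>
    Nat.rec (motive := fun n => (S n).1) ⟨univ, rfl⟩ (fun n U => child n (S n) U (b n)) n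
  have hDcl : ∀ n b, closure (D (n + 1) b).1 ⊆ (D n b).1 := fun n b =>
    (hchild n (S n) (D n b) (b n)).1
  have hDdist : ∀ n b, ∀ y ∈ (D (n + 1) b).1, ∀ z ∈ (D (n + 1) b).1,
      dist y z ≤ (1 / 2 : ℝ) ^ n := fun n b => (hchild n (S n) (D n b) (b n)).2
  have hDanti : ∀ b, Antitone fun n => (D n b).1 := fun b =>
    antitone_nat_of_succ_le fun n => subset_closure.trans (hDcl n b)
  have hpt : ∀ n, ∃ x, ∀ U ∈ (S n).1, x ∈ f '' U := fun n => by
    obtain ⟨x, hx⟩ := (S n).2.2.2 univ MeasurableSet.univ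
      ((CoveredByInjOn.of_injOn MeasurableSet.empty (by simp)).mono (by simp))
    exact ⟨x, fun U hU => by simpa using hx U hU⟩
  -- One value per level serves all branches: the approximants of different branches have equal
  -- images, hence so do their limits.
  choose x hx using hpt
  have hpre : ∀ b n, ∃ e ∈ (D (n + 1) b).1, f e = x (n + 1) := fun b n => hx _ _ (D (n + 1) b).2
  choose e heD hex using hpre
  have hcauchy : ∀ b, CauchySeq (e b) := fun b => by
    refine cauchySeq_of_le_tendsto_0 (fun n => (1 / 2 : ℝ) ^ n) (fun n m N hn hm => ?_)
      (tendsto_pow_atTop_nhds_zero_of_lt_one (by norm_num) (by norm_num))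
    exact hDdist N b _ (hDanti b (Nat.succ_le_succ hn) (heD b n)) _
      (hDanti b (Nat.succ_le_succ hm) (heD b m))
  choose l hl using fun b => cauchySeq_tendsto_of_complete (hcauchy b)
  have hlD : ∀ b n, l b ∈ (D n b).1 := fun b n => by
    refine hDcl n b (mem_closure_of_tendsto (hl b) ?_)
    filter_upwards [Filter.eventually_ge_atTop n] with m hm
    exact hDanti b (Nat.succ_le_succ hm) (heD b m)
  have hlinj : Function.Injective l := by
    intro b b' hbb
    by_contra hne
    have hex : ∃ n, b n ≠ b' n := by
      by_contra hall
      push Not at hall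
      exact hne (funext hall)
    classical
    have hmin : ∀ m < Nat.find hex, b m = b' m := fun m hm => by
      simpa using Nat.find_min hex hm
    have hsame : ∀ m ≤ Nat.find hex, D m b = D m b' := by
      intro m
      induction m with
      | zero => exact fun _ => rfl
      | succ m ih =>
        intro hm
        change child m (S m) (D m b) (b m) = child m (S m) (D m b') (b' m)
        rw [ih (Nat.le_of_succ_le hm), hmin m hm]
    have h1 := hlD b (Nat.find hex + 1)
    have h2 := hlD b' (Nat.find hex + 1)
    rw [← hbb] at h2
    change l b ∈ (child _ (S _) (D _ b) (b _)).1 at h1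
    change l b ∈ (child _ (S _) (D _ b') (b' _)).1 at h2
    rw [hsame _ le_rfl] at h1
    have hd := hdis (Nat.find hex) (S (Nat.find hex)) (D (Nat.find hex) b')
    have hn : b (Nat.find hex) ≠ b' (Nat.find hex) := Nat.find_spec hex
    generalize b (Nat.find hex) = i at *
    generalize b' (Nat.find hex) = j at *
    cases i <;> cases j
    · exact hn rfl
    · exact Set.disjoint_left.1 hd h1 h2
    · exact Set.disjoint_left.1 hd h2 h1
    · exact hn rfl
  have hlim : ∀ b, Filter.Tendsto (fun n => x (n + 1)) Filter.atTop (nhds (f (l b))) := fun b => by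
    have := (hf.tendsto (l b)).comp (hl b)
    refine this.congr fun n => hex b n
  refine ⟨f (l fun _ => false), fun hcount => ?_⟩
  have hr : (range l).Countable := hcount.mono (by
    rintro _ ⟨b, rfl⟩
    exact tendsto_nhds_unique (hlim b) (hlim _))
  have := hr.to_subtype
  have : Countable (ℕ → Bool) := (Equiv.ofInjective l hlinj).injective.countable
  obtain ⟨g, hg⟩ := exists_surjective_nat (ℕ → Bool)
  obtain ⟨n, hn⟩ := hg fun k => !(g k k)
  simpa using congrFun hn n

end Polish

/-- A countable-to-one Borel map between standard Borel spaces is injective on each piece of some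
countable Borel cover. -/
theorem Measurable.exists_cover_injOn {E X : Type*} [MeasurableSpace E] [StandardBorelSpace E]
    [MeasurableSpace X] [StandardBorelSpace X] {f : E → X} (hf : Measurable f)
    (hc : ∀ x, (f ⁻¹' {x}).Countable) : CoveredByInjOn f univ := by
  let := upgradeStandardBorel X
  obtain ⟨τ, hτb, hτp⟩ := StandardBorelSpace.polish (α := E)
  obtain ⟨t, ht, hft, hpt⟩ := hf.exists_continuous
  have hB : @BorelSpace E t _ := by
    refine @BorelSpace.mk _ t _ ?_
    rw [borel_eq_borel_of_le hpt hτp ht, ← hτb.measurable_eq]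
  clear ht hτb hτp
  clear τ
  let := upgradeIsCompletelyMetrizable E
  by_contra hcon
  obtain ⟨x, hx⟩ := PositiveFamily.exists_uncountable_fiber hft (by
    intro B hB hBc
    by_contra hempty
    -- For the family `{univ}`, any point of `B` supplies a common value, so positivity can fail
    -- only at the empty set.
    have hBe : B = ∅ := by
      by_contra hne
      obtain ⟨e, he⟩ := nonempty_iff_ne_empty.2 hne
      exact hempty ⟨f e, by rintro _ rfl; exact ⟨e, ⟨trivial, he⟩, rfl⟩⟩
    rw [hBe, compl_empty] at hBc
    exact hcon hBc)
  exact hx (hc x)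

end LusinNovikov

/-- A countable Borel quasi-order is generated by countably many Borel functions. -/
theorem IsCountableBorelQuasiOrder.exists_functions {X : Type*} [MeasurableSpace X]
    {Q : X → X → Prop} (hQ : IsCountableBorelQuasiOrder Q) :
    ∃ f : ℕ → X → X, (∀ n, Measurable (f n)) ∧ ∀ x y, Q y x ↔ ∃ n, f n x = y := by
  classical
  have := hQ.standardBorel
  let E := {p : X × X | Q p.1 p.2}
  have : StandardBorelSpace E := hQ.borel.standardBorel
  let π : E → X := fun p => p.1.2
  have hπ : Measurable π := measurable_snd.comp measurable_subtype_coe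
  have hρ : Measurable fun p : E => p.1.1 := measurable_fst.comp measurable_subtype_coe
  obtain ⟨B, hB, hi, hcov⟩ := hπ.exists_cover_injOn fun x => by
    refine Set.MapsTo.countable_of_injOn (f := fun p : E => p.1.1) (t := {y | Q y x}) ?_ ?_
      (hQ.countable_predecessors x)
    · rintro ⟨⟨y, z⟩, hp⟩ rfl
      exact hp
    · rintro ⟨⟨y, z⟩, _⟩ rfl ⟨⟨y', z'⟩, _⟩ hz hy
      exact Subtype.ext (Prod.ext hy hz.symm)
  -- Each function inverts `π` on one piece; the default value `x` off the image is harmless because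
  -- `Q` is reflexive.
  have hex : ∀ n x, ∃ y, (x ∈ π '' B n → ∃ p ∈ B n, p.1.2 = x ∧ p.1.1 = y) ∧
      (x ∉ π '' B n → y = x) := fun n x => by
    by_cases hx : x ∈ π '' B n
    · obtain ⟨p, hp, rfl⟩ := hx
      exact ⟨p.1.1, fun _ => ⟨p, hp, rfl, rfl⟩, fun h => (h ⟨p, hp, rfl⟩).elim⟩
    · exact ⟨x, fun h => (hx h).elim, fun _ => rfl⟩
  choose f hf1 hf2 using hex
  refine ⟨f, fun n T hT => ?_, fun x y => ⟨fun hxy => ?_, ?_⟩⟩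
  · have : f n ⁻¹' T = π '' (B n ∩ (fun p : E => p.1.1) ⁻¹' T) ∪ ((π '' B n)ᶜ ∩ T) := by
      ext x
      by_cases hx : x ∈ π '' B n
      · obtain ⟨p, hp, hpx, hpy⟩ := hf1 n x hx
        constructor
        · intro hxT
          exact Or.inl ⟨p, ⟨hp, by change p.1.1 ∈ T; rw [hpy]; exact hxT⟩, hpx⟩
        · rintro (⟨q, ⟨hq, hqT⟩, hqx⟩ | h)
          · have : q = p := hi n hq hp (hqx.trans hpx.symm)
            subst this
            change f n x ∈ T
            rw [← hpy]
            exact hqT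
          · exact (h.1 hx).elim
      · constructor
        · intro hxT
          exact Or.inr ⟨hx, by rw [← hf2 n x hx]; exact hxT⟩
        · rintro (⟨q, ⟨hq, _⟩, hqx⟩ | h)
          · exact (hx ⟨q, hq, hqx⟩).elim
          · change f n x ∈ T
            rw [hf2 n x hx]
            exact h.2
    rw [this]
    refine MeasurableSet.union ?_ (MeasurableSet.inter (MeasurableSet.compl ?_) hT)
    · exact ((hB n).inter (hρ hT)).image_of_measurable_injOn hπ
        ((hi n).mono Set.inter_subset_left)
    · exact (hB n).image_of_measurable_injOn hπ (hi n)
  · obtain ⟨n, hn⟩ := Set.mem_iUnion.1 (hcov (Set.mem_univ (⟨(y, x), hxy⟩ : E)))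
    obtain ⟨p, hp, hpx, hpy⟩ := hf1 n x ⟨_, hn, rfl⟩
    have : p = ⟨(y, x), hxy⟩ := hi n hp hn hpx
    exact ⟨n, by rw [← hpy, this]⟩
  · rintro ⟨n, rfl⟩
    by_cases hx : x ∈ π '' B n
    · obtain ⟨p, hp, hpx, hpy⟩ := hf1 n x hx
      have hp : Q p.1.1 p.1.2 := p.2
      rwa [hpx, hpy] at hp
    · rw [hf2 n x hx]
      exact hQ.refl x

/-! ### The quasi-order of finite intersections of translates -/

section TranslateIntersection

variable {G : Type*} [Group G]

theorem TranslateIntersectionLE.refl (A : Set G) : TranslateIntersectionLE G A A :=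
  ⟨1, le_rfl, fun _ => 1, by simp [Set.iInter_const]⟩

theorem TranslateIntersectionLE.of_finite {ι : Type*} [Finite ι] [Nonempty ι] {A B : Set G}
    (g : ι → G) (h : A = ⋂ i, g i • B) : TranslateIntersectionLE G A B := by
  obtain ⟨n, ⟨e⟩⟩ := Finite.exists_equiv_fin ι
  refine ⟨n, ?_, fun i => g (e.symm i), ?_⟩
  · exact Fin.pos (e (Classical.arbitrary ι))
  · rw [h]
    exact (e.symm.surjective.iInter_comp fun i => g i • B).symm

theorem TranslateIntersectionLE.trans {A B C : Set G} (hAB : TranslateIntersectionLE G A B)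
    (hBC : TranslateIntersectionLE G B C) : TranslateIntersectionLE G A C := by
  obtain ⟨n, hn, g, rfl⟩ := hAB
  obtain ⟨m, hm, h, rfl⟩ := hBC
  have : Nonempty (Fin n × Fin m) := ⟨⟨0, hn⟩, ⟨0, hm⟩⟩
  refine TranslateIntersectionLE.of_finite (fun p : Fin n × Fin m => g p.1 * h p.2) ?_
  ext a
  simp [Set.smul_set_iInter, smul_smul, Prod.forall]

theorem TranslateIntersectionLE.countable_predecessors [Countable G] (B : Set G) :
    {A | TranslateIntersectionLE G A B}.Countable := by
  refine (Set.countable_range fun p : Σ n, Fin n → G => ⋂ i, p.2 i • B).mono ?_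
  rintro A ⟨n, _, g, rfl⟩
  exact ⟨⟨n, g⟩, rfl⟩

theorem TranslateIntersectionLE.measurableSet [Countable G] :
    MeasurableSet {p : Set G × Set G | TranslateIntersectionLE G p.1 p.2} := by
  have : {p : Set G × Set G | TranslateIntersectionLE G p.1 p.2} =
      ⋃ n : ℕ, ⋃ _ : 1 ≤ n, ⋃ g : Fin n → G, ⋂ a : G,
        {p | a ∈ p.1 ↔ ∀ i, (g i)⁻¹ • a ∈ p.2} := by
    ext p
    simp only [TranslateIntersectionLE, Set.mem_ofPred_eq, Set.mem_iUnion, Set.mem_iInter,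
      Set.ext_iff, exists_prop, Set.mem_smul_set_iff_inv_smul_mem]
  rw [this]
  refine MeasurableSet.iUnion fun n => MeasurableSet.iUnion fun _ => MeasurableSet.iUnion fun g =>
    MeasurableSet.iInter fun a => measurableSet_setOfPred.2 (Measurable.iff ?_ ?_)
  · exact (measurable_set_mem a).comp measurable_fst
  · exact Measurable.forall fun i => (measurable_set_mem _).comp measurable_snd

theorem measurableSet_setOf_infinite (α : Type*) [Countable α] :
    MeasurableSet {A : Set α | A.Infinite} := by
  have : {A : Set α | A.Infinite}ᶜ = ⋃ F : Finset α, {(F : Set α)} := by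
    ext A
    simp only [Set.mem_compl_iff, Set.mem_ofPred_eq, Set.not_infinite, Set.mem_iUnion,
      Set.mem_singleton_iff]
    exact ⟨fun h => ⟨h.toFinset, by simp⟩, by rintro ⟨F, rfl⟩; exact F.finite_toSet⟩
  rw [← MeasurableSet.compl_iff, this]
  refine MeasurableSet.iUnion fun F => ?_
  have : ({(F : Set α)} : Set (Set α)) = ⋂ a, {A | a ∈ A ↔ a ∈ (F : Set α)} := by
    ext A
    simp [Set.ext_iff]
  rw [this]
  exact MeasurableSet.iInter fun a =>
    measurableSet_setOfPred.2 ((measurable_set_mem a).iff measurable_const)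

theorem standardBorelSpace_set (α : Type*) [Countable α] : StandardBorelSpace (Set α) :=
  inferInstanceAs (StandardBorelSpace (α → Prop))

theorem isCountableBorelQuasiOrder_translateIntersectionLE (G : Type*) [Group G] [Countable G] :
    IsCountableBorelQuasiOrder (TranslateIntersectionLE G) where
  standardBorel := standardBorelSpace_set G
  refl := .refl
  trans _ _ _ := .trans
  borel := TranslateIntersectionLE.measurableSet
  countable_predecessors := TranslateIntersectionLE.countable_predecessors

theorem isCountableBorelQuasiOrder_translateIntersectionLEOnInfinite (G : Type*) [Group G]
    [Countable G] : IsCountableBorelQuasiOrder (TranslateIntersectionLEOnInfinite G) where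
  standardBorel :=
    have := standardBorelSpace_set G
    (measurableSet_setOf_infinite G).standardBorel
  refl A := .refl A.1
  trans _ _ _ := .trans
  borel := TranslateIntersectionLE.measurableSet.preimage
    (measurable_subtype_coe.prodMap measurable_subtype_coe)
  countable_predecessors B :=
    (TranslateIntersectionLE.countable_predecessors B.1).preimage Subtype.val_injective

/-- An injective homomorphism preserves and reflects the quasi-order on nonempty sets. -/
theorem translateIntersectionLE_image_iff {H : Type*} [Group H] {φ : H →* G}
    (hφ : Function.Injective φ) {A B : Set H} (hA : A.Nonempty) :
    TranslateIntersectionLE G (φ '' A) (φ '' B) ↔ TranslateIntersectionLE H A B := by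
  have himage : ∀ {n : ℕ} (_ : 1 ≤ n) (h : Fin n → H),
      φ '' ⋂ i, h i • B = ⋂ i, φ (h i) • φ '' B := fun {n} hn h => by
    have : Nonempty (Fin n) := ⟨⟨0, hn⟩⟩
    rw [hφ.injOn.image_iInter_eq]
    exact Set.iInter_congr fun i => Set.image_smul_distrib φ _ _
  constructor
  · rintro ⟨n, hn, g, hg⟩
    obtain ⟨a, ha⟩ := hA
    -- A point of `φ '' A` lies in every `g i • φ '' B`, which forces each `g i` into the range of
    -- `φ`.
    have hmem : ∀ i, ∃ h, φ h = g i := fun i => by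
      have := hg ▸ Set.mem_image_of_mem φ ha
      obtain ⟨_, ⟨b, _, rfl⟩, hb⟩ := Set.mem_iInter.1 this i
      exact ⟨a * b⁻¹, by rw [map_mul, map_inv, ← hb]; simp⟩
    choose h hh using hmem
    refine ⟨n, hn, h, hφ.image_injective ?_⟩
    rw [hg, himage hn]
    simp only [hh]
  · rintro ⟨n, hn, h, rfl⟩
    exact ⟨n, hn, fun i => φ (h i), himage hn h⟩

theorem measurable_image_of_countable {α β : Type*} [Countable α] (φ : α → β) :
    Measurable fun A : Set α => φ '' A := by
  refine measurable_set_iff.2 fun b => ?_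
  exact Measurable.exists fun a => (measurable_set_mem a).and measurable_const

end TranslateIntersection

/-! ### Free groups -/

section FreeGroup

open FreeGroup

/-- The conjugates `a ^ n * b * (a ^ n)⁻¹` generate freely: sending `b` to `of 0` and `a` to the
shift in the semidirect product takes them to the free generators `of n`. -/
theorem FreeGroup.exists_injective_int_fin_two :
    ∃ θ : FreeGroup ℤ →* FreeGroup (Fin 2), Function.Injective θ := by
  let φ : Multiplicative ℤ →* MulAut (FreeGroup ℤ) :=
    { toFun := fun m => freeGroupCongr (Equiv.addRight m.toAdd)
      map_one' := by
        ext g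
        induction g using FreeGroup.induction_on <;> simp_all
      map_mul' := fun m n => by
        ext g
        induction g using FreeGroup.induction_on <;>
          simp_all [add_comm, add_left_comm] }
  let ψ : FreeGroup (Fin 2) →* FreeGroup ℤ ⋊[φ] Multiplicative ℤ :=
    FreeGroup.lift ![SemidirectProduct.inl (of 0), SemidirectProduct.inr (Multiplicative.ofAdd 1)]
  let θ : FreeGroup ℤ →* FreeGroup (Fin 2) :=
    FreeGroup.lift fun n => of 1 ^ n * of 0 * (of 1 ^ n)⁻¹
  have h : ψ.comp θ = SemidirectProduct.inl := by
    ext1 n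
    have h1 : φ (Multiplicative.ofAdd n) (of 0) = of n := by simp [φ]
    have h2 : ψ (of 0) = SemidirectProduct.inl (of 0) := lift_apply_of
    have h3 : ψ (of 1) = SemidirectProduct.inr (Multiplicative.ofAdd 1) := lift_apply_of
    have h4 : θ (of n) = of 1 ^ n * of 0 * (of 1 ^ n)⁻¹ := lift_apply_of
    rw [MonoidHom.comp_apply, h4, _root_.map_mul, _root_.map_mul, _root_.map_inv,
      map_zpow, h2, h3]
    rw [← map_zpow, ← ofAdd_zsmul, smul_eq_mul, mul_one, ← _root_.map_inv,
      ← SemidirectProduct.inl_aut, h1]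
  refine ⟨θ, Function.Injective.of_comp (f := ψ) ?_⟩
  rw [← MonoidHom.coe_comp, h]
  exact SemidirectProduct.inl_injective

variable {S : Type*}

/-- The element of the free group represented by a word without inverse letters. -/
def FreeGroup.ofList (w : List S) : FreeGroup S :=
  FreeGroup.mk (w.map fun s => (s, true))

theorem FreeGroup.ofList_append (u w : List S) : ofList (u ++ w) = ofList u * ofList w := by
  simp [ofList]

theorem FreeGroup.ofList_cons (s : S) (w : List S) : ofList (s :: w) = of s * ofList w :=
  ofList_append [s] w

theorem FreeGroup.isReduced_map_true (w : List S) :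
    IsReduced (w.map fun s => (s, true)) := by
  rw [IsReduced, List.isChain_map]
  induction w with
  | nil => exact .nil
  | cons a w ih => cases w <;> simp_all

theorem FreeGroup.ofList_injective : Function.Injective (ofList (S := S)) := by
  classical
  intro u w h
  have := congrArg toWord h
  rw [ofList, ofList, toWord_mk, toWord_mk, (isReduced_map_true u).reduce_eq,
    (isReduced_map_true w).reduce_eq] at this
  exact List.map_injective_iff.2 (fun a b h => congrArg Prod.fst h) this

/-- If `s * g` and `t * g` are both products of generators, for distinct generators `s` and `t`,
then so is `g`. -/
theorem FreeGroup.exists_ofList_of_mul {s t : S} (hst : s ≠ t) {g : FreeGroup S} {u w : List S}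
    (hs : of s * g = ofList u) (ht : of t * g = ofList w) : ∃ z, g = ofList z := by
  classical
  -- Unless `u` starts with `s`, the word `s⁻¹u` is reduced, so the first letter of `g` determines
  -- `s`.
  have key : ∀ {s : S} {u : List S}, of s * g = ofList u →
      (∃ z, g = ofList z) ∨ g.toWord = (s, false) :: u.map fun s => (s, true) := by
    intro s u hs
    by_cases hu : ∃ z, u = s :: z
    · obtain ⟨z, rfl⟩ := hu
      rw [ofList_cons] at hs
      exact Or.inl ⟨z, mul_left_cancel hs⟩
    · right
      have hg : g = mk ((s, false) :: u.map fun s => (s, true)) := by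
        rw [eq_inv_mul_of_mul_eq hs, ofList, of, inv_mk, mul_mk]
        rfl
      rw [hg, toWord_mk, IsReduced.reduce_eq]
      cases u with
      | nil => exact IsReduced.singleton
      | cons a z =>
        refine isReduced_cons_cons.2 ⟨fun h => ?_, isReduced_map_true (a :: z)⟩
        have h : s = a := h
        exact (hu ⟨z, by rw [h]⟩).elim
  rcases key hs with h | h
  · exact h
  rcases key ht with h' | h'
  · exact h'
  rw [h] at h'
  exact (hst (congrArg Prod.fst (List.cons.inj h').1)).elim

end FreeGroup

/-! ### Coding a quasi-order by sets of words -/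

section Coding

/-- Letters of the coding: `none` accepts everything after it, `some (inl n)` applies the `n`-th
function, and `some (inr (k, b))` tests whether the `k`-th bit of the current point is `b`. -/
abbrev CodeLetter : Type := Option (ℕ ⊕ ℕ × Bool)

variable {X : Type*} (f : ℕ → X → X) (c : X → ℕ → Bool)

/-- The set of points at which a word is accepted. -/
def acceptSet : List CodeLetter → Set X
  | [] => Set.univ
  | none :: _ => Set.univ
  | some (Sum.inl n) :: w => f n ⁻¹' acceptSet w
  | some (Sum.inr (k, b)) :: _ => {x | c x k = b}

/-- The set of elements of the free group represented by the words accepted at `x`. -/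
def codeSet (x : X) : Set (FreeGroup CodeLetter) :=
  FreeGroup.ofList '' {w | x ∈ acceptSet f c w}

variable {f c}

theorem ofList_mem_codeSet {x : X} {w : List CodeLetter} :
    FreeGroup.ofList w ∈ codeSet f c x ↔ x ∈ acceptSet f c w :=
  FreeGroup.ofList_injective.mem_set_image

theorem codeSet_infinite (x : X) : (codeSet f c x).Infinite := by
  refine Set.Infinite.image FreeGroup.ofList_injective.injOn ?_
  refine Set.infinite_of_injective_forall_mem
    (f := fun n : ℕ => none :: List.replicate n (none : CodeLetter)) ?_ fun n => ?_
  · intro m n h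
    simpa using congrArg List.length h
  · exact Set.mem_univ x

theorem measurableSet_acceptSet [MeasurableSpace X] (hf : ∀ n, Measurable (f n))
    (hc : Measurable c) : ∀ w, MeasurableSet (acceptSet f c w)
  | [] => MeasurableSet.univ
  | none :: _ => MeasurableSet.univ
  | some (Sum.inl n) :: w => hf n (measurableSet_acceptSet hf hc w)
  | some (Sum.inr (k, b)) :: _ => (measurable_pi_apply k).comp hc (measurableSet_singleton b)

theorem measurable_codeSet [MeasurableSpace X] (hf : ∀ n, Measurable (f n)) (hc : Measurable c) :
    Measurable (codeSet f c) := by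
  refine measurable_set_iff.2 fun g => ?_
  refine Measurable.exists fun w => Measurable.and ?_ measurable_const
  exact measurableSet_setOfPred.1 (measurableSet_acceptSet hf hc w)

/-- The translate for `some (inl n)` alone could contain elements that are not positive words; by
`FreeGroup.exists_ofList_of_mul`, intersecting with the `none`-translate removes them. -/
theorem codeSet_apply (n : ℕ) (x : X) :
    codeSet f c (f n x) = (FreeGroup.of (none : CodeLetter))⁻¹ • codeSet f c x ∩
      (FreeGroup.of (some (Sum.inl n) : CodeLetter))⁻¹ • codeSet f c x := by
  ext g
  rw [Set.mem_inter_iff, Set.mem_smul_set_iff_inv_smul_mem, Set.mem_smul_set_iff_inv_smul_mem,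
    inv_inv, inv_inv, smul_eq_mul, smul_eq_mul]
  constructor
  · rintro ⟨w, hw, rfl⟩
    rw [← FreeGroup.ofList_cons, ← FreeGroup.ofList_cons, ofList_mem_codeSet, ofList_mem_codeSet]
    exact ⟨trivial, hw⟩
  · rintro ⟨h1, h2⟩
    obtain ⟨u, _, hu⟩ := id h1
    obtain ⟨w, _, hw⟩ := id h2
    obtain ⟨z, rfl⟩ := FreeGroup.exists_ofList_of_mul (Option.some_ne_none _).symm hu.symm hw.symm
    rw [← FreeGroup.ofList_cons, ofList_mem_codeSet] at h2
    exact ofList_mem_codeSet.2 h2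

/-- After reading an accepted word `u`, the automaton either accepts everything, or is at a point
obtained from the start by the functions `f n`. -/
theorem acceptSet_append {Q : X → X → Prop} (hrefl : ∀ x, Q x x)
    (htrans : ∀ x y z, Q x y → Q y z → Q x z) (hf : ∀ n x, Q (f n x) x) :
    ∀ (u : List CodeLetter) (x : X), x ∈ acceptSet f c u →
      (∀ w, x ∈ acceptSet f c (u ++ w)) ∨
        ∃ z, Q z x ∧ ∀ w, x ∈ acceptSet f c (u ++ w) ↔ z ∈ acceptSet f c w
  | [], x, _ => Or.inr ⟨x, hrefl x, fun _ => Iff.rfl⟩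
  | none :: _, _, _ => Or.inl fun _ => trivial
  | some (Sum.inr (_, _)) :: _, _, hx => Or.inl fun _ => hx
  | some (Sum.inl n) :: u, x, hx => by
    rcases acceptSet_append hrefl htrans hf u (f n x) hx with h | ⟨z, hz, h⟩
    · exact Or.inl h
    · exact Or.inr ⟨z, htrans _ _ _ hz (hf n x), h⟩

theorem translateIntersectionLE_codeSet_iff {Q : X → X → Prop} (hrefl : ∀ x, Q x x)
    (htrans : ∀ x y z, Q x y → Q y z → Q x z) (hf : ∀ x y, Q y x ↔ ∃ n, f n x = y)
    (hc : Function.Injective c) (y x : X) :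
    Q y x ↔ TranslateIntersectionLE (FreeGroup CodeLetter) (codeSet f c y) (codeSet f c x) := by
  constructor
  · intro hyx
    obtain ⟨n, rfl⟩ := (hf x y).1 hyx
    refine .of_finite (fun b : Bool => cond b (FreeGroup.of (none : CodeLetter))⁻¹
      (FreeGroup.of (some (Sum.inl n) : CodeLetter))⁻¹) ?_
    rw [codeSet_apply, Set.inter_eq_iInter]
    exact Set.iInter_congr fun b => by cases b <;> rfl
  · rintro ⟨n, -, g, hg⟩
    have hmem : ∀ w, y ∈ acceptSet f c w ↔ ∀ i, (g i)⁻¹ * FreeGroup.ofList w ∈ codeSet f c x := by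
      intro w
      rw [← ofList_mem_codeSet, hg]
      simp only [Set.mem_iInter, Set.mem_smul_set_iff_inv_smul_mem, smul_eq_mul]
    -- The empty word is always accepted, so each `(g i)⁻¹` itself lies in the code of `x`.
    have hu : ∀ i, ∃ u, x ∈ acceptSet f c u ∧ (g i)⁻¹ = FreeGroup.ofList u := fun i => by
      obtain ⟨u, hu, h⟩ := (hmem []).1 trivial i
      exact ⟨u, hu, by rw [h]; exact (mul_one _).symm⟩
    choose u hux hgu using hu
    simp only [hgu, ← FreeGroup.ofList_append, ofList_mem_codeSet] at hmem
    -- Otherwise `y` would accept every word, including the test for the wrong value of its bit 0.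
    have hnot : ¬ ∀ i, ∀ w, x ∈ acceptSet f c (u i ++ w) := fun hall => by
      have : y ∈ acceptSet f c [some (Sum.inr (0, !(c y 0)))] := (hmem _).2 fun i => hall i _
      have : c y 0 = !(c y 0) := this
      simp at this
    push Not at hnot
    obtain ⟨i, w, hw⟩ := hnot
    rcases acceptSet_append hrefl htrans (fun n x => (hf x _).2 ⟨n, rfl⟩) (u i) x (hux i) with
      h | ⟨z, hz, h⟩
    · exact (hw (h w)).elim
    -- Every word accepted at `y` is accepted at `z`; applied to the tests for the bits of `y`, this
    -- gives `c z = c y`.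
    · have : z = y := hc (funext fun k =>
        (h [some (Sum.inr (k, c y k))]).1 ((hmem [some (Sum.inr (k, c y k))]).1 rfl i))
      rwa [← this]

end Coding

/-! ### Reductions and universality. -/

/-- If the free group on two generators embeds in `G`, every countable Borel quasi-order reduces
to the translate-intersection quasi-order on the infinite subsets of `G`. -/
theorem IsCountableBorelQuasiOrder.borelReducible_infiniteSubsets {X : Type*} [MeasurableSpace X]
    {Q : X → X → Prop} (hQ : IsCountableBorelQuasiOrder Q) {G : Type*} [Group G]
    (φ : FreeGroup (Fin 2) →* G) (hφ : Function.Injective φ) :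
    BorelReducible Q (TranslateIntersectionLEOnInfinite G) := by
  have := hQ.standardBorel
  obtain ⟨f, hf, hfQ⟩ := hQ.exists_functions
  obtain ⟨c, hc, hci⟩ := MeasurableSpace.measurable_injection_nat_bool_of_countablySeparated X
  obtain ⟨θ, hθ⟩ := FreeGroup.exists_injective_int_fin_two
  obtain ⟨e, he⟩ := exists_injective_nat CodeLetter
  let ψ : FreeGroup CodeLetter →* G := (φ.comp θ).comp (FreeGroup.map fun s => (e s : ℤ))
  have hψ : Function.Injective ψ :=
    (hφ.comp hθ).comp (FreeGroup.map_injective (Nat.cast_injective.comp he))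
  refine ⟨fun x => ⟨ψ '' codeSet f c x, (codeSet_infinite x).image hψ.injOn⟩,
    ((measurable_image_of_countable ψ).comp (measurable_codeSet hf hc)).subtype_mk, fun y x => ?_⟩
  rw [TranslateIntersectionLEOnInfinite,
    translateIntersectionLE_image_iff hψ (codeSet_infinite y).nonempty]
  exact translateIntersectionLE_codeSet_iff hQ.refl hQ.trans hfQ hci y x

theorem isUniversalCountableBorelQuasiOrder_infiniteSubsets.{w} {G : Type*} [Group G] [Countable G]
    (φ : FreeGroup (Fin 2) →* G) (hφ : Function.Injective φ) :
    IsUniversalCountableBorelQuasiOrder.{w} (TranslateIntersectionLEOnInfinite G) :=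
  ⟨isCountableBorelQuasiOrder_translateIntersectionLEOnInfinite G,
    fun _ _ _ hQ => hQ.borelReducible_infiniteSubsets φ hφ⟩

theorem mainTheorem8 :
    IsUniversalCountableBorelQuasiOrder.{v}
      (TranslateIntersectionLEOnInfinite (FreeGroup ℕ)) ∧
    IsUniversalCountableBorelQuasiOrder.{v}
      (TranslateIntersectionLEOnInfinite (FreeGroup (Fin 2))) ∧
    IsUniversalCountableBorelQuasiOrder.{v}
      (TranslateIntersectionLE (FreeGroup (Fin 2))) ∧
    ∀ (G : Type u) [Group G] [Countable G] (φ : FreeGroup (Fin 2) →* G),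
      Function.Injective φ →
        IsUniversalCountableBorelQuasiOrder.{v} (TranslateIntersectionLEOnInfinite G) := by
  refine ⟨?_, ?_, ⟨isCountableBorelQuasiOrder_translateIntersectionLE _, fun X _ Q hQ => ?_⟩, ?_⟩
  · exact isUniversalCountableBorelQuasiOrder_infiniteSubsets (FreeGroup.map Fin.val)
      (FreeGroup.map_injective Fin.val_injective)
  · exact isUniversalCountableBorelQuasiOrder_infiniteSubsets (MonoidHom.id _)
      Function.injective_id
  · obtain ⟨f, hf, hQf⟩ := hQ.borelReducible_infiniteSubsets
      (MonoidHom.id (FreeGroup (Fin 2))) Function.injective_id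
    exact ⟨fun x => (f x).1, measurable_subtype_coe.comp hf, hQf⟩
  · exact fun G _ _ φ hφ => isUniversalCountableBorelQuasiOrder_infiniteSubsets φ hφ
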